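/- Let $\mathcal{A}$ be a finite set of actions. A bandit with action set $\mathcal{A}$ is a stochastic process $\{R_t\}_{t=1}^{\infty}$ with values in $\mathbb{R}^{\mathcal{A}}$, defined on some probability space; $R_{t+1,a}$ is the reward received upon executing action $a$ at timestep $t\in\{0,1,2,\dots\}$. The bandit is stationary if for all $T\ge 0$, all actions $a_1,\dots,a_T\in\mathcal{A}$, and all sequences $t_1,\dots,t_T$ and $t'_1,\dots,t'_T$ of positive integers, each consisting of distinct elements, the random vectors $(R_{t_1,a_1},\dots,R_{t_T,a_T})$ and $(R_{t'_1,a_1},\dots,R_{t'_T,a_T})$ are equal in distribution. A policy $\pi$ maps each history (finite sequence of action-reward pairs), measurably, to a probability distribution over $\mathcal{A}$. Executing $\pi$ in the bandit generates histories $H_0^\pi,H_1^\pi,\dots$: $H_0^\pi$ is the empty history; the action $A_t^\pi$ has conditional distribution $\pi(\cdot\mid H_t^\pi)$ given $H_t^\pi$ and is conditionally independent of $\{R_s\}_{s=1}^{\infty}$ given $H_t^\pi$; and $H_{t+1}^\pi=(H_t^\pi,A_t^\pi,R_{t+1,A_t^\pi})$. Two bandits with the same action set (possibly defined on different probability spaces)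 are equivalent if for every policy $\pi$ and every $T\ge 0$ the histories $H_T^\pi$ generated in the two bandits are equal in distribution. Theorem. A bandit $\{R_t\}_{t=1}^{\infty}$ with finite action set $\mathcal{A}$ is stationary if and only if it is equivalent to some bandit $\{R'_t\}_{t=1}^{\infty}$ with action set $\mathcal{A}$ whose sequence of reward vectors is exchangeable, i.e. such that for every $n$ and every permutation $\sigma$ of $\{1,\dots,n\}$, $(R'_{\sigma(1)},\dots,R'_{\sigma(n)})$ and $(R'_1,\dots,R'_n)$ are equal in distribution. -/

import Mathlib

open MeasureTheory ProbabilityTheory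

universe u v w

/-- A bandit with action set `A`: a stochastic process `R₁, R₂, …` on a probability space, with
values in `A → ℝ` (one reward for every action). The process is indexed from zero: `reward t` is
the reward vector `R_{t+1}`, whose coordinate `a` is what an agent receives on executing the
action `a` at timestep `t`. -/
structure Bandit (A : Type w) where
  /-- The underlying sample space. -/
  Ω : Type u
  [measurableSpace : MeasurableSpace Ω]
  /-- The probability measure on the sample space. -/
  P : Measure Ω
  [isProbabilityMeasure : IsProbabilityMeasure P]
  /-- The reward process. -/
  reward : ℕ → Ω → A → ℝ
  measurable_reward : ∀ t, Measurable (reward t)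

attribute [instance] Bandit.measurableSpace Bandit.isProbabilityMeasure

/-- Histories of length `t`: the sequences of `t` action-reward pairs. -/
abbrev History (A : Type w) (t : ℕ) : Type w := Fin t → A × ℝ

/-- A policy maps every history (of any length), measurably, to a probability distribution over
the actions. -/
structure Policy (A : Type w) [MeasurableSpace A] where
  /-- The distribution of the next action, given the history of length `t`. -/
  act : ∀ t, Kernel (History A t) A
  [isMarkovKernel : ∀ t, IsMarkovKernel (act t)]

attribute [instance] Policy.isMarkovKernel

namespace Bandit

variable {A : Type w}

/-- A bandit is stationary if, for a fixed sequence of actions, the joint distribution of the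
rewards of these actions at distinct timesteps does not depend on the timesteps. -/
def IsStationary (B : Bandit.{u} A) : Prop :=
  ∀ (T : ℕ) (a : Fin T → A) (s s' : Fin T → ℕ), Function.Injective s → Function.Injective s' →
    IdentDistrib (fun ω k => B.reward (s k) ω (a k)) (fun ω k => B.reward (s' k) ω (a k)) B.P B.P

/-- The sequence of reward vectors is exchangeable: permuting any finite initial segment does not
change its joint distribution. -/
def IsExchangeable (B : Bandit.{u} A) : Prop :=
  ∀ (n : ℕ) (σ : Equiv.Perm (Fin n)),
    IdentDistrib (fun ω (i : Fin n) => B.reward (σ i) ω) (fun ω (i : Fin n) => B.reward i ω)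
      B.P B.P

variable [MeasurableSpace A]

/-- One interaction: the history `h` is extended by the action `a` executed at timestep `t` and
the reward received for it. The sample point is kept. -/
def extend (B : Bandit.{u} A) (t : ℕ) (p : (B.Ω × History A t) × A) : B.Ω × History A (t + 1) :=
  (p.1.1, Fin.snoc (α := fun _ => A × ℝ) p.1.2 (p.2, B.reward t p.1.1 p.2))

/-- The joint law of the sample point (hence of the whole reward process) and of the history at
timestep `t`, when the policy `π` is executed. The history starts empty. At timestep `t`, given
the sample point and the history `h`, the action has the distribution `π.act t h`: it has that
conditional distribution given the history, and is conditionally independent of the rewards given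
the history. -/
noncomputable def jointLaw (B : Bandit.{u} A) (π : Policy A) :
    (t : ℕ) → Measure (B.Ω × History A t)
  | 0 => B.P.map fun ω => (ω, Fin.elim0)
  | t + 1 =>
    (B.jointLaw π t ⊗ₘ (π.act t).comap Prod.snd measurable_snd).map (B.extend t)

/-- The distribution of the history at timestep `T`, when the policy `π` is executed. -/
noncomputable def historyLaw (B : Bandit.{u} A) (π : Policy A) (T : ℕ) : Measure (History A T) :=
  (B.jointLaw π T).map Prod.snd

/-- Two bandits with the same action set are equivalent if under every policy, at every timestep,
the two histories are equal in distribution. -/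
def Equivalent (B : Bandit.{u} A) (B' : Bandit.{v} A) : Prop :=
  ∀ (π : Policy A) (T : ℕ), B.historyLaw π T = B'.historyLaw π T

end Bandit

/-! A policy sees one coordinate of the reward vector per timestep. The density of a history splits
into the policy's probabilities for the actions and the law of the rewards along those actions
(`lintegral_historyLaw`), so equivalence means equal reward laws along every fixed action sequence
(`equivalent_iff`). Given a stationary bandit and an injection `φ : ℕ × A → ℕ`, put `R'_{t,a} =
R_{φ(t,a),a}`. All entries of `R'` come from distinct timesteps, so stationarity makes the law of a
finite block invariant under permuting rows, and preserves the laws along action sequences.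
Conversely, exchangeability implies stationarity, which concerns one coordinate per timestep and so
passes through equivalence. -/

open scoped ENNReal

/-- Two finite injective families of natural numbers differ by a permutation of some initial
segment of `ℕ`. -/
lemma exists_perm_fin_of_injective {ι : Type*} [Finite ι] {s s' : ι → ℕ}
    (hs : Function.Injective s) (hs' : Function.Injective s') :
    ∃ (n : ℕ) (σ : Equiv.Perm (Fin n)) (u u' : ι → Fin n),
      (∀ k, (u k : ℕ) = s k) ∧ (∀ k, (u' k : ℕ) = s' k) ∧ ∀ k, σ (u' k) = u k := by
  obtain ⟨m, hm⟩ := (Set.finite_range s).bddAbove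
  obtain ⟨m', hm'⟩ := (Set.finite_range s').bddAbove
  have h (k) : s k < max m m' + 1 :=
    Nat.lt_succ_of_le ((hm ⟨k, rfl⟩).trans (le_max_left _ _))
  have h' (k) : s' k < max m m' + 1 :=
    Nat.lt_succ_of_le ((hm' ⟨k, rfl⟩).trans (le_max_right _ _))
  obtain ⟨σ, hσ⟩ := Equiv.Perm.exists_extending_pair
    (fun k => (⟨s' k, h' k⟩ : Fin (max m m' + 1))) (fun k => ⟨s k, h k⟩)
    (fun i j hij => hs' (Fin.mk.inj_iff.1 hij)) (fun i j hij => hs (Fin.mk.inj_iff.1 hij))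
  exact ⟨_, σ, _, _, fun _ => rfl, fun _ => rfl, fun k => hσ k⟩

/-! ### Stationarity, exchangeability and the reindexed bandit -/

namespace Bandit

variable {A : Type w}

lemma measurable_reward_apply (B : Bandit.{u} A) (t : ℕ) (a : A) :
    Measurable fun ω => B.reward t ω a :=
  (measurable_pi_apply a).comp (B.measurable_reward t)

lemma measurable_rewards {ι : Type*} (B : Bandit.{u} A) (s : ι → ℕ) (a : ι → A) :
    Measurable fun ω k => B.reward (s k) ω (a k) :=
  measurable_pi_lambda _ fun k => B.measurable_reward_apply (s k) (a k)

/-- Arbitrary finite index types are needed for blocks indexed by `Fin n × A`. -/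
lemma IsStationary.map_rewards_eq {B : Bandit.{u} A} (hB : B.IsStationary) {ι : Type*}
    [Finite ι] (a : ι → A) {s s' : ι → ℕ} (hs : Function.Injective s)
    (hs' : Function.Injective s') :
    B.P.map (fun ω k => B.reward (s k) ω (a k)) =
      B.P.map fun ω k => B.reward (s' k) ω (a k) := by
  obtain ⟨n, ⟨e⟩⟩ := Finite.exists_equiv_fin ι
  have h := (hB n (a ∘ e.symm) (s ∘ e.symm) (s' ∘ e.symm) (hs.comp e.symm.injective)
    (hs'.comp e.symm.injective)).comp (u := fun (x : Fin n → ℝ) (k : ι) => x (e k))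
    (measurable_pi_lambda _ fun k => measurable_pi_apply _)
  simpa [Function.comp_def] using h.map_eq

lemma IsExchangeable.isStationary {B : Bandit.{u} A} (hB : B.IsExchangeable) :
    B.IsStationary := by
  intro T a s s' hs hs'
  obtain ⟨n, σ, u, u', hu, hu', hσ⟩ := exists_perm_fin_of_injective hs hs'
  have h := (hB n σ).comp (u := fun (x : Fin n → A → ℝ) (k : Fin T) => x (u' k) (a k))
    (measurable_pi_lambda _ fun k => (measurable_pi_apply _).comp (measurable_pi_apply _))
  simpa [Function.comp_def, hσ, hu, hu'] using h

/-- The bandit whose reward for the action `a` at timestep `t` is the reward of `B` for `a` at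
timestep `φ (t, a)`, realized on a space of sequences in an arbitrary universe. -/
noncomputable def reindex [Finite A] (B : Bandit.{u} A) (φ : ℕ × A → ℕ) : Bandit.{v} A where
  -- Indexing by `Fin (Nat.card A)` instead of `A` keeps the universe of `A` out of the sample
  -- space.
  Ω := ULift.{v} (ℕ → Fin (Nat.card A) → ℝ)
  P := B.P.map fun ω => ULift.up fun t i =>
    B.reward (φ (t, (Finite.equivFin A).symm i)) ω ((Finite.equivFin A).symm i)
  isProbabilityMeasure := Measure.isProbabilityMeasure_map
    (measurable_up.comp (measurable_pi_lambda _ fun _ =>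
      measurable_pi_lambda _ fun _ => B.measurable_reward_apply _ _)).aemeasurable
  reward t x a := x.down t (Finite.equivFin A a)
  measurable_reward t := measurable_pi_lambda _ fun _ =>
    (measurable_pi_apply _).comp ((measurable_pi_apply t).comp measurable_down)

lemma map_reindex [Finite A] (B : Bandit.{u} A) (φ : ℕ × A → ℕ) {E : Type*} [MeasurableSpace E]
    {F : (ℕ → A → ℝ) → E} (hF : Measurable F) :
    (B.reindex φ : Bandit.{v} A).P.map (fun x => F fun t => (B.reindex φ).reward t x) =
      B.P.map fun ω => F fun t a => B.reward (φ (t, a)) ω a := by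
  have h : Measurable fun ω => (ULift.up fun t i =>
      B.reward (φ (t, (Finite.equivFin A).symm i)) ω ((Finite.equivFin A).symm i) :
        ULift.{v} (ℕ → Fin (Nat.card A) → ℝ)) :=
    measurable_up.comp (measurable_pi_lambda _ fun _ =>
      measurable_pi_lambda _ fun _ => B.measurable_reward_apply _ _)
  refine (Measure.map_map (hF.comp (measurable_pi_lambda _
    fun t => (B.reindex φ).measurable_reward t)) h).trans ?_
  congr 1
  funext ω
  simp [reindex]

lemma IsStationary.isExchangeable_reindex [Finite A] {B : Bandit.{u} A} (hB : B.IsStationary)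
    {φ : ℕ × A → ℕ} (hφ : Function.Injective φ) :
    (B.reindex φ : Bandit.{v} A).IsExchangeable := by
  intro n σ
  have key (τ : Equiv.Perm (Fin n)) :
      (B.reindex φ : Bandit.{v} A).P.map (fun x (i : Fin n) => (B.reindex φ).reward (τ i) x) =
        (B.P.map fun ω (p : Fin n × A) => B.reward (φ (τ p.1, p.2)) ω p.2).map
          fun y i a => y (i, a) := by
    rw [Measure.map_map (measurable_pi_lambda _ fun _ => measurable_pi_lambda _ fun _ =>
      measurable_pi_apply _) (B.measurable_rewards (fun p => φ (τ p.1, p.2)) Prod.snd)]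
    exact B.map_reindex φ (F := fun r (i : Fin n) => r (τ i))
      (measurable_pi_lambda _ fun _ => measurable_pi_apply _)
  have inj (τ : Equiv.Perm (Fin n)) :
      Function.Injective fun p : Fin n × A => φ ((τ p.1 : ℕ), p.2) := by
    rintro ⟨i, a⟩ ⟨j, b⟩ h
    simpa [Fin.val_inj] using hφ h
  refine ⟨(measurable_pi_lambda _ fun _ => measurable_reward _ _).aemeasurable,
    (measurable_pi_lambda _ fun _ => measurable_reward _ _).aemeasurable, ?_⟩
  refine (key σ).trans (Eq.trans ?_ (key 1).symm)
  rw [hB.map_rewards_eq Prod.snd (inj σ) (inj 1)]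

lemma IsStationary.map_rewards_reindex [Finite A] {B : Bandit.{u} A} (hB : B.IsStationary)
    {φ : ℕ × A → ℕ} (hφ : Function.Injective φ) (T : ℕ) (a : Fin T → A) :
    B.P.map (fun ω (k : Fin T) => B.reward k ω (a k)) =
      (B.reindex φ : Bandit.{v} A).P.map fun ω (k : Fin T) => (B.reindex φ).reward k ω (a k) := by
  refine Eq.trans ?_ (B.map_reindex φ (F := fun r (k : Fin T) => r k (a k))
    (measurable_pi_lambda _ fun _ =>
      (measurable_pi_apply _).comp (measurable_pi_apply _))).symm
  refine hB.map_rewards_eq a Fin.val_injective (s' := fun k => φ (k, a k)) fun i j h => ?_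
  exact Fin.val_injective (Prod.mk.inj (hφ h)).1

end Bandit

/-! ### Laws of histories -/

section Policy

variable {A : Type w} [MeasurableSpace A]

/-- The probability that the policy `π` takes the actions recorded in the history `h`, when it
receives the rewards recorded there. -/
noncomputable def Policy.weight (π : Policy A) : (t : ℕ) → History A t → ℝ≥0∞
  | 0, _ => 1
  | t + 1, h => Policy.weight π t (Fin.init h) * π.act t (Fin.init h) {(h (Fin.last t)).1}

/-- The policy that executes a fixed sequence of actions. -/
noncomputable def Policy.openLoop (b : ℕ → A) : Policy A where
  act t := Kernel.const _ (Measure.dirac (b t))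

end Policy

namespace Bandit

variable {A : Type w}

/-- The history in which the actions `a` are executed and the rewards `r` are received. -/
def historyOf {t : ℕ} (a : Fin t → A) (r : Fin t → ℝ) : History A t := fun k => (a k, r k)

lemma historyOf_snoc {t : ℕ} (a : Fin t → A) (b : A) (r : Fin (t + 1) → ℝ) :
    historyOf (Fin.snoc (α := fun _ => A) a b) r =
      Fin.snoc (α := fun _ => A × ℝ) (historyOf a (Fin.init r)) (b, r (Fin.last t)) := by
  funext k
  refine Fin.lastCases ?_ (fun k => ?_) k <;> simp [historyOf, Fin.init]

variable [MeasurableSpace A]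

lemma measurable_historyOf {t : ℕ} (a : Fin t → A) : Measurable (historyOf a) :=
  measurable_pi_lambda _ fun k => measurable_const.prodMk (measurable_pi_apply k)

lemma measurable_historyOf_rewards (B : Bandit.{u} A) {t : ℕ} (a : Fin t → A) :
    Measurable fun ω => historyOf a fun k => B.reward k ω (a k) :=
  (measurable_historyOf a).comp (B.measurable_rewards _ _)

lemma measurable_snoc {t : ℕ} :
    Measurable fun p : History A t × (A × ℝ) =>
      (Fin.snoc (α := fun _ => A × ℝ) p.1 p.2 : History A (t + 1)) := by
  refine measurable_pi_lambda _ fun k => ?_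
  refine Fin.lastCases ?_ (fun k => ?_) k
  · simpa using measurable_snd
  · simpa [Function.comp_def] using (measurable_pi_apply k).comp
      (measurable_fst : Measurable (Prod.fst : History A t × (A × ℝ) → History A t))

variable [Finite A] [DiscreteMeasurableSpace A]

lemma measurable_extend (B : Bandit.{u} A) (t : ℕ) : Measurable (B.extend t) := by
  refine measurable_from_prod_countable_left fun a => ?_
  exact measurable_fst.prodMk (measurable_snoc.comp (measurable_snd.prodMk
    (measurable_const.prodMk ((B.measurable_reward_apply t a).comp measurable_fst))))

instance isProbabilityMeasure_jointLaw (B : Bandit.{u} A) (π : Policy A) (t : ℕ) :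
    IsProbabilityMeasure (B.jointLaw π t) := by
  induction t with
  | zero =>
    exact Measure.isProbabilityMeasure_map (measurable_id.prodMk measurable_const).aemeasurable
  | succ t ih => exact Measure.isProbabilityMeasure_map (B.measurable_extend t).aemeasurable

lemma measurable_weight (π : Policy A) (t : ℕ) : Measurable (π.weight t) := by
  induction t with
  | zero => exact measurable_const
  | succ t ih =>
    have hinit : Measurable fun h : History A (t + 1) => (Fin.init h : History A t) :=
      measurable_pi_lambda _ fun k => measurable_pi_apply _
    have hact : Measurable fun p : History A t × A => π.act t p.1 {p.2} :=
      measurable_from_prod_countable_left fun a =>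
        (π.act t).measurable_coe (measurableSet_singleton a)
    exact (ih.comp hinit).mul (hact.comp
      (hinit.prodMk (measurable_fst.comp (measurable_pi_apply (Fin.last t)))))

/-- An integral against the joint law is a sum over the sequences of actions. -/
lemma lintegral_jointLaw [Fintype A] (B : Bandit.{u} A) (π : Policy A) (t : ℕ)
    {f : B.Ω × History A t → ℝ≥0∞} (hf : Measurable f) :
    ∫⁻ p, f p ∂B.jointLaw π t = ∑ a : Fin t → A, ∫⁻ ω,
      π.weight t (historyOf a fun k => B.reward k ω (a k)) *
        f (ω, historyOf a fun k => B.reward k ω (a k)) ∂B.P := by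
  induction t with
  | zero =>
    have hm : Measurable fun ω : B.Ω => (ω, (Fin.elim0 : History A 0)) :=
      measurable_id.prodMk measurable_const
    rw [jointLaw, lintegral_map hf hm]
    simp only [Policy.weight, one_mul, Fintype.sum_unique]
    congr! with ω
  | succ t ih =>
    have hfe : Measurable fun p => f (B.extend t p) := hf.comp (B.measurable_extend t)
    rw [jointLaw, lintegral_map hf (B.measurable_extend t), Measure.lintegral_compProd hfe]
    simp only [Kernel.comap_apply, lintegral_fintype]
    have hm (a : A) : Measurable fun p : B.Ω × History A t =>
        f (B.extend t (p, a)) * π.act t p.2 {a} :=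
      (hfe.comp (measurable_id.prodMk measurable_const)).mul
        (((π.act t).measurable_coe (measurableSet_singleton a)).comp measurable_snd)
    rw [lintegral_finsetSum _ fun a _ => hm a]
    simp only [ih (hm _)]
    rw [← (Fin.snocEquiv fun _ => A).sum_comp, Fintype.sum_prod_type]
    refine Finset.sum_congr rfl fun b _ => Finset.sum_congr rfl fun a _ => ?_
    refine lintegral_congr fun ω => ?_
    have hh : historyOf (Fin.snocEquiv (fun _ => A) (b, a))
        (fun k => B.reward k ω (Fin.snocEquiv (fun _ => A) (b, a) k)) =
          Fin.snoc (α := fun _ => A × ℝ) (historyOf a fun k => B.reward k ω (a k))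
            (b, B.reward t ω b) := by
      refine (historyOf_snoc a b _).trans ?_
      simp [Fin.snocEquiv, Fin.init_def]
    rw [hh]
    simp only [Policy.weight, Fin.init_snoc, Fin.snoc_last, extend]
    ring

/-- On the right, the bandit enters only through its reward laws along fixed action sequences. -/
lemma lintegral_historyLaw [Fintype A] (B : Bandit.{u} A) (π : Policy A) (t : ℕ)
    {f : History A t → ℝ≥0∞} (hf : Measurable f) :
    ∫⁻ h, f h ∂B.historyLaw π t = ∑ a : Fin t → A,
      ∫⁻ r, π.weight t (historyOf a r) * f (historyOf a r)
        ∂B.P.map fun ω (k : Fin t) => B.reward k ω (a k) := by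
  have hf' : Measurable fun p : B.Ω × History A t => f p.2 := hf.comp measurable_snd
  rw [historyLaw, lintegral_map hf measurable_snd,
    B.lintegral_jointLaw π t hf']
  refine Finset.sum_congr rfl fun a _ => ?_
  have hm : Measurable fun r => π.weight t (historyOf a r) * f (historyOf a r) :=
    ((measurable_weight π t).comp (measurable_historyOf a)).mul
      (hf.comp (measurable_historyOf a))
  rw [lintegral_map hm (B.measurable_rewards (fun k : Fin t => (k : ℕ)) a)]

lemma historyLaw_openLoop (B : Bandit.{u} A) (b : ℕ → A) (t : ℕ) :
    B.historyLaw (Policy.openLoop b) t =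
      B.P.map fun ω => historyOf (fun k : Fin t => b k) fun k => B.reward k ω (b k) := by
  have hm (t : ℕ) : Measurable fun ω =>
      (ω, historyOf (fun k : Fin t => b k) fun k => B.reward k ω (b k)) :=
    measurable_id.prodMk (B.measurable_historyOf_rewards _)
  have h : B.jointLaw (Policy.openLoop b) t = B.P.map fun ω =>
      (ω, historyOf (fun k : Fin t => b k) fun k => B.reward k ω (b k)) := by
    induction t with
    | zero =>
      rw [jointLaw]
      congr! with ω
    | succ t ih =>
      refine Measure.ext_of_lintegral _ fun f hf => ?_
      have hfe : Measurable fun p => f (B.extend t p) := hf.comp (B.measurable_extend t)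
      rw [jointLaw, lintegral_map hf (B.measurable_extend t), Measure.lintegral_compProd hfe]
      simp only [Kernel.comap_apply, Policy.openLoop, Kernel.const_apply, lintegral_dirac]
      have ih' : B.jointLaw ⟨fun t => Kernel.const _ (Measure.dirac (b t))⟩ t = _ := ih
      have hfb : Measurable fun p => f (B.extend t (p, b t)) :=
        hfe.comp (measurable_id.prodMk measurable_const)
      rw [ih', lintegral_map hfb (hm t),
        lintegral_map hf (hm (t + 1))]
      refine lintegral_congr fun ω => ?_
      simp only [extend]
      congr 2
      funext k
      refine Fin.lastCases ?_ (fun k => ?_) k <;> simp [historyOf]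
  rw [historyLaw, h, Measure.map_map measurable_snd (hm t)]
  rfl

/-- Bandits are equivalent if and only if fixed sequences of actions receive equally distributed
rewards. -/
lemma equivalent_iff (B : Bandit.{u} A) (B' : Bandit.{v} A) :
    B.Equivalent B' ↔ ∀ (T : ℕ) (a : Fin T → A),
      B.P.map (fun ω (k : Fin T) => B.reward k ω (a k)) =
        B'.P.map fun ω (k : Fin T) => B'.reward k ω (a k) := by
  constructor
  · intro h T a
    have key (b : ℕ → A) :
        B.P.map (fun ω (k : Fin T) => B.reward k ω (b k)) =
          B'.P.map fun ω (k : Fin T) => B'.reward k ω (b k) := by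
      have hb := h (Policy.openLoop b) T
      rw [historyLaw_openLoop, historyLaw_openLoop] at hb
      have hr : Measurable fun (x : History A T) k => (x k).2 :=
        measurable_pi_lambda _ fun k => measurable_snd.comp (measurable_pi_apply k)
      have hb' := congrArg (Measure.map fun (x : History A T) k => (x k).2) hb
      rwa [Measure.map_map hr (B.measurable_historyOf_rewards _),
        Measure.map_map hr (B'.measurable_historyOf_rewards _)] at hb'
    -- `A` may be empty when `T = 0`; otherwise `a` extends periodically to `ℕ`.
    rcases T with _ | T
    · have hB : (fun ω (k : Fin 0) => B.reward k ω (a k)) = fun _ => Fin.elim0 := by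
        funext ω k; exact k.elim0
      have hB' : (fun ω (k : Fin 0) => B'.reward k ω (a k)) = fun _ => Fin.elim0 := by
        funext ω k; exact k.elim0
      rw [hB, hB', Measure.map_const, Measure.map_const, measure_univ, measure_univ]
    · simpa using key fun t => a (Fin.ofNat (T + 1) t)
  · intro h π T
    have := Fintype.ofFinite A
    refine Measure.ext_of_lintegral _ fun f hf => ?_
    rw [B.lintegral_historyLaw π T hf, B'.lintegral_historyLaw π T hf]
    simp only [h]

/-- Equivalence controls rewards on initial segments; those at timesteps `s` are a projection of
one. -/
lemma Equivalent.isStationary {B : Bandit.{u} A} {B' : Bandit.{v} A} (h : B.Equivalent B')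
    (hB' : B'.IsStationary) : B.IsStationary := by
  rw [equivalent_iff] at h
  intro T a s s' hs hs'
  refine ⟨(B.measurable_rewards s a).aemeasurable, (B.measurable_rewards s' a).aemeasurable, ?_⟩
  have key {s : Fin T → ℕ} (hs : Function.Injective s) :
      B.P.map (fun ω k => B.reward (s k) ω (a k)) =
        B'.P.map fun ω k => B'.reward (s k) ω (a k) := by
    rcases T with _ | T
    · convert h 0 a
    obtain ⟨n, _, u, _, hu, _, _⟩ := exists_perm_fin_of_injective hs hs
    have hu_inj : Function.Injective u := fun i j hij => hs (by rw [← hu, ← hu, hij])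
    -- Actions at timesteps outside the range of `s` are arbitrary, since the projection discards
    -- them.
    let b : Fin n → A := fun i => a (Function.invFun u i)
    have hb (k) : b (u k) = a k := congrArg a (Function.leftInverse_invFun hu_inj k)
    have hr : Measurable fun (x : Fin n → ℝ) k => x (u k) :=
      measurable_pi_lambda _ fun k => measurable_pi_apply _
    have hb' := congrArg (Measure.map fun (x : Fin n → ℝ) k => x (u k)) (h n b)
    rw [Measure.map_map hr (B.measurable_rewards _ _),
      Measure.map_map hr (B'.measurable_rewards _ _)] at hb'
    simpa [Function.comp_def, hb, hu] using hb'
  rw [key hs, key hs', (hB' T a s s' hs hs').map_eq]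

end Bandit

theorem theorem4 {A : Type w} [Finite A] [MeasurableSpace A] [DiscreteMeasurableSpace A]
    (B : Bandit.{u} A) :
    B.IsStationary ↔ ∃ B' : Bandit.{v} A, B.Equivalent B' ∧ B'.IsExchangeable := by
  constructor
  · intro hB
    obtain ⟨φ, hφ⟩ := exists_injective_nat (ℕ × A)
    exact ⟨B.reindex φ, (B.equivalent_iff _).2 (hB.map_rewards_reindex hφ),
      hB.isExchangeable_reindex hφ⟩
  · rintro ⟨B', h, hB'⟩
    exact h.isStationary hB'.isStationary
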